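/- Let $\alpha>1$, $\lambda_0,\lambda_1,r,\delta>0$ and $A_\alpha=\frac{(\alpha-1)^{\alpha-1}}{\alpha^\alpha}$. Write $x\wedge\delta=\min(x,\delta)$ and $y_+=\max(y,0)$. Consider the first-order nonlinear delay ODE $$A_\alpha\lambda_0\,v'(x)^{1-\alpha}+A_\alpha\lambda_1\,(x\wedge\delta)^\alpha\,\bigl(v(x)-v((x-\delta)_+)\bigr)^{1-\alpha}-r\,v(x)=0\quad(x>0),\qquad v(0)=0. \tag{1}$$ A solution is a continuous function $v:[0,\infty)\to\mathbb R$ with $v(0)=0$ that at every $x>0$ is differentiable, has $v'(x)>0$ and $v(x)-v((x-\delta)_+)>0$ (so that the powers with the negative exponent $1-\alpha$ make sense), and satisfies (1). Then (1) has a unique solution $v$. It remains unique if differentiability, the two positivity conditions and (1) are required only at points $x>0$ other than the knots $\delta,2\delta,3\delta,\dots$. Moreover, $v$ is obtained by successive patching: there are functions $v_{(n)}$, $n\ge 0$, such that $v=v_{(n)}$ on $[n\delta,(n+1)\delta]$ for every $n\ge0$, where * $v_{(0)}$ is the unique solution on $[0,\delta]$ of $A_\alpha\lambda_0 v_{(0)}'(x)^{1-\alpha}+A_\alpha\lambda_1x^\alpha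 v_{(0)}(x)^{1-\alpha}-r v_{(0)}(x)=0$ with $v_{(0)}(0)=0$; * for each $n\ge0$, $v_{(n+1)}$ is the unique solution on $[(n+1)\delta,(n+2)\delta]$ of $A_\alpha\lambda_0 v_{(n+1)}'(x)^{1-\alpha}+A_\alpha\lambda_1\delta^\alpha\bigl(v_{(n+1)}(x)-v_{(n)}(x-\delta)\bigr)^{1-\alpha}-r v_{(n+1)}(x)=0$ with $v_{(n+1)}((n+1)\delta)=v_{(n)}((n+1)\delta)$. Here a solution on a closed interval is a continuous function on it with the given initial value that, at every interior point, is differentiable, has positive bases in both powers with exponent $1-\alpha$, and satisfies the equation. -/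

import Mathlib

open Set

noncomputable section

/-- The constant `A_α = (α - 1)^(α - 1) / α^α`. -/
def depthConst (α : ℝ) : ℝ := (α - 1) ^ (α - 1) / α ^ α

/-- At the point `x`, the function `u` satisfies
`A_α lam0 u'(x)^(1-α) + A_α lam1 q^α (u(x) - d)^(1-α) - r u(x) = 0`.
The exponent `1 - α` is negative, so the equation presupposes that `u'(x)` exists and
that both bases `u'(x)` and `u(x) - d` are positive. -/
def SolvesAt (α lam0 lam1 r q d : ℝ) (u : ℝ → ℝ) (x : ℝ) : Prop :=
  ∃ p : ℝ, 0 < p ∧ HasDerivAt u p x ∧ 0 < u x - d ∧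
    depthConst α * lam0 * p ^ (1 - α) + depthConst α * lam1 * q ^ α * (u x - d) ^ (1 - α)
      - r * u x = 0

/-- `v` is a continuous function on `[0, ∞)` with `v(0) = 0` that satisfies the delay equation
`A_α lam0 v'(x)^(1-α) + A_α lam1 (x ∧ δ)^α (v(x) - v((x-δ)₊))^(1-α) - r v(x) = 0`
at every `x > 0` outside the exceptional set `S` (values of `v` on `(-∞, 0)` are irrelevant;
at `x = 0` the equation forces `v'(0) = ∞`, and only the initial condition is imposed). -/
structure IsDelaySolution (α lam0 lam1 r δ : ℝ) (S : Set ℝ) (v : ℝ → ℝ) : Prop where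
  continuousOn : ContinuousOn v (Ici 0)
  initial : v 0 = 0
  solves : ∀ x : ℝ, 0 < x → x ∉ S →
    SolvesAt α lam0 lam1 r (min x δ) (v (max (x - δ) 0)) v x

/-- The knots `0, δ, 2δ, …`. -/
def knots (δ : ℝ) : Set ℝ := {x | ∃ n : ℕ, x = n * δ}

/-- `u` solves, on `[a, b]` and with `u(a) = c`, the ordinary differential equation
`A_α lam0 u'(x)^(1-α) + A_α lam1 q(x)^α (u(x) - d(x))^(1-α) - r u(x) = 0`
with given functions `q` and `d`. -/
structure IsPieceSolution (α lam0 lam1 r a b c : ℝ) (q d u : ℝ → ℝ) : Prop where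
  continuousOn : ContinuousOn u (Icc a b)
  initial : u a = c
  solves : ∀ x ∈ Ioo a b, SolvesAt α lam0 lam1 r (q x) (d x) u x

/-- `u` is, on `[a, b]`, the one and only solution of that initial value problem. -/
def IsUniquePieceSolution (α lam0 lam1 r a b c : ℝ) (q d u : ℝ → ℝ) : Prop :=
  IsPieceSolution α lam0 lam1 r a b c q d u ∧
    ∀ w : ℝ → ℝ, IsPieceSolution α lam0 lam1 r a b c q d w → EqOn w u (Icc a b)

end

open Topology

/-! Solved for the slope, the equation on one piece is `u' = κ G ^ (-β)` with `β = 1 / (α - 1)` and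
`G = r u - B (u - d) ^ (1 - α)`. Since `G` increases with `u`, the larger of two solutions has the
smaller slope; this contraction gives uniqueness (`IsPieceSolution.eqOn`). For existence, `G` and
the gap `u - d` are truncated from below, Picard-Lindelöf solves the truncated equation on the whole
interval, and the truncations turn out inactive. If `G` comes down to a small level `ε`, the slope
is so large that `G` increases again, and a small gap would make `G` negative
(`exists_solution_of_regular_start`). At `0` the slope is infinite; a power substitution removes
this (`exists_solution_of_singular_start`). Each later piece starts regularly, because the positive
slope at the end of the previous piece means `G > 0` there. At a knot both one-sided slopes satisfy
the same equation, so they agree. -/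

lemma depthConst_pos {α : ℝ} (hα : 1 < α) : 0 < depthConst α :=
  div_pos (Real.rpow_pos_of_pos (by linarith) _) (Real.rpow_pos_of_pos (by linarith) _)

/-! ### Truncated equations and the barrier argument -/

/-- The function `s ↦ max s m ^ (-γ)` is Lipschitz. -/
lemma abs_max_rpow_neg_sub_le {γ m : ℝ} (hγ : 0 < γ) (hm : 0 < m) (s t : ℝ) :
    |max s m ^ (-γ) - max t m ^ (-γ)| ≤ γ * m ^ (-γ - 1) * |s - t| := by
  have h : ∀ x ∈ Ici m, HasDerivWithinAt (fun x : ℝ => x ^ (-γ)) (-γ * x ^ (-γ - 1)) (Ici m) x :=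
    fun x hx => (Real.hasDerivAt_rpow_const
      (Or.inl (hm.trans_le hx).ne')).hasDerivWithinAt
  have hb : ∀ x ∈ Ici m, ‖-γ * x ^ (-γ - 1)‖ ≤ γ * m ^ (-γ - 1) := fun x hx => by
    have hx0 : 0 < x := hm.trans_le hx
    rw [norm_mul, Real.norm_eq_abs, Real.norm_eq_abs, abs_neg, abs_of_pos hγ,
      abs_of_pos (Real.rpow_pos_of_pos hx0 _)]
    exact mul_le_mul_of_nonneg_left
      (Real.rpow_le_rpow_of_nonpos hm hx (by linarith)) hγ.le
  have key := (convex_Ici m).norm_image_sub_le_of_norm_hasDerivWithin_le h hb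
    (le_max_right t m) (le_max_right s m)
  simp only [Real.norm_eq_abs] at key
  refine key.trans (mul_le_mul_of_nonneg_left ?_ (by positivity))
  exact abs_max_sub_max_le_abs s t m

/-- Existence for `w' = κ max(Φ(x, w), ε)^(-β)`, `w(a) = c`. -/
lemma exists_regularized_solution {κ β ε K a b : ℝ} (hκ : 0 ≤ κ) (hβ : 0 < β) (hε : 0 < ε)
    (hK : 0 ≤ K) (hab : a ≤ b) (c : ℝ) (Φ : ℝ → ℝ → ℝ)
    (hΦx : ∀ y, ContinuousOn (fun x => Φ x y) (Icc a b))
    (hΦy : ∀ x ∈ Icc a b, ∀ y z, |Φ x y - Φ x z| ≤ K * |y - z|) :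
    ∃ w : ℝ → ℝ, w a = c ∧ ∀ x ∈ Icc a b,
      HasDerivWithinAt w (κ * max (Φ x (w x)) ε ^ (-β)) (Icc a b) x := by
  have hM : 0 ≤ κ * ε ^ (-β) := by positivity
  have hN : 0 ≤ κ * (β * ε ^ (-β - 1) * K) := by positivity
  -- The truncation bounds the field by `κ * ε ^ (-β)` for every `y`, so a ball of that radius times
  -- `b - a` lets the solution reach `b`.
  have hpl : IsPicardLindelof (fun x y => κ * max (Φ x y) ε ^ (-β))
      (⟨a, left_mem_Icc.2 hab⟩ : Icc a b) c
      (NNReal.mk (κ * ε ^ (-β) * (b - a)) (mul_nonneg hM (by linarith))) 0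
      (NNReal.mk (κ * ε ^ (-β)) hM) (NNReal.mk (κ * (β * ε ^ (-β - 1) * K)) hN) := by
    refine ⟨fun x hx => ?_, fun y _ => ?_, fun x hx y _ => ?_, ?_⟩
    · refine LipschitzOnWith.of_dist_le_mul fun y _ z _ => ?_
      simp only [Real.dist_eq, NNReal.coe_mk]
      rw [← mul_sub, abs_mul, abs_of_nonneg hκ, mul_assoc]
      refine mul_le_mul_of_nonneg_left ?_ hκ
      refine (abs_max_rpow_neg_sub_le hβ hε _ _).trans ?_
      rw [mul_assoc (β * ε ^ (-β - 1))]
      exact mul_le_mul_of_nonneg_left (hΦy x hx y z) (by positivity)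
    · refine continuousOn_const.mul (ContinuousOn.rpow_const (ContinuousOn.sup (hΦx y) continuousOn_const) ?_)
      exact fun x _ => Or.inl (lt_max_of_lt_right hε).ne'
    · have h0 : 0 < max (Φ x y) ε := lt_max_of_lt_right hε
      rw [Real.norm_eq_abs, abs_of_nonneg (by positivity), NNReal.coe_mk]
      exact mul_le_mul_of_nonneg_left
        (Real.rpow_le_rpow_of_nonpos hε (le_max_right _ _) (by linarith)) hκ
    · simp [max_eq_left (sub_nonneg.2 hab)]
  exact hpl.exists_eq_forall_mem_Icc_hasDerivWithinAt₀

lemma HasDerivWithinAt.of_Icc_Ici {f : ℝ → ℝ} {p a b x : ℝ} (h : HasDerivWithinAt f p (Icc a b) x)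
    (hx : x ∈ Ico a b) : HasDerivWithinAt f p (Ici x) x :=
  (h.mono (Icc_subset_Icc_left hx.1)).mono_of_mem_nhdsWithin (Icc_mem_nhdsGE hx.2)

/-- A continuous function that increases whenever it equals `ε` cannot fall below `ε`. -/
lemma le_of_deriv_pos_of_eq {D : ℝ → ℝ} {s b ε : ℝ} (hD : ContinuousOn D (Icc s b))
    (hs : ε ≤ D s)
    (hpos : ∀ x ∈ Ico s b, D x = ε → ∃ p, 0 < p ∧ HasDerivWithinAt D p (Ici x) x) :
    ∀ x ∈ Icc s b, ε ≤ D x := by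
  have hcl : IsClosed ({x | ε ≤ D x} ∩ Icc s b) := by
    rw [inter_comm]
    exact hD.preimage_isClosed_of_isClosed isClosed_Icc isClosed_Ici
  refine hcl.Icc_subset_of_forall_exists_gt hs ?_
  rintro x ⟨hx, hxI⟩ y hy
  have hmem : ∀ᶠ z in 𝓝[>] x, z ∈ Ioc x y := Ioc_mem_nhdsGT hy
  rcases (show ε ≤ D x from hx).eq_or_lt with h | h
  · obtain ⟨p, hp, hd⟩ := hpos x hxI h.symm
    have hfr := hd.neg.liminf_right_slope_le (r := 0) (by linarith)
    obtain ⟨z, hz, hzI⟩ := (hfr.and_eventually hmem).exists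
    refine ⟨z, ?_, hzI⟩
    have hzx : 0 < z - x := sub_pos.2 hzI.1
    rw [slope_def_field, div_lt_iff₀ hzx, zero_mul] at hz
    simp only [Pi.neg_apply] at hz
    change ε ≤ D z
    linarith
  · have hc : ContinuousWithinAt D (Ioi x) x :=
      (hD x (Ico_subset_Icc_self hxI)).mono_of_mem_nhdsWithin
        (Filter.mem_of_superset (Ioc_mem_nhdsGT hxI.2)
          fun z hz => ⟨hxI.1.trans hz.1.le, hz.2⟩)
    obtain ⟨z, hz, hzI⟩ := ((hc.eventually (lt_mem_nhds h)).and hmem).exists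
    exact ⟨z, hz.le, hzI⟩

/-- Solving `A p^(1-α) = G` for `p`. -/
lemma mul_rpow_one_sub {α β A G : ℝ} (hβ : β * (α - 1) = 1) (hA : 0 < A) (hG : 0 < G) :
    A * (A ^ β * G ^ (-β)) ^ (1 - α) = G := by
  rw [Real.mul_rpow (by positivity) (by positivity), ← Real.rpow_mul hA.le, ← Real.rpow_mul hG.le,
    show β * (1 - α) = -1 by linarith, show -β * (1 - α) = 1 by linarith, Real.rpow_one,
    Real.rpow_neg_one]
  field_simp

/-- Supplies truncation levels low enough for the negative power to beat a prescribed bound. -/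
lemma exists_mul_rpow_neg_gt {κ β : ℝ} (hκ : 0 < κ) (hβ : 0 < β) (L : ℝ) {ε₀ : ℝ} (hε₀ : 0 < ε₀) :
    ∃ ε, 0 < ε ∧ ε < ε₀ ∧ L < κ * ε ^ (-β) := by
  have h := (tendsto_rpow_neg_nhdsGT_zero (y := -β) (by linarith)).const_mul_atTop hκ
  have h2 := (h.eventually_gt_atTop L).and (Ioo_mem_nhdsGT hε₀)
  obtain ⟨ε, h1, h2⟩ := h2.exists
  exact ⟨ε, h2.1, h2.2, h1⟩

/-! ### Uniqueness on one interval -/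

/-- Solutions of the initial value problem on an interval are unique: the square of the difference
of two solutions is nonincreasing. -/
lemma IsPieceSolution.eqOn {α lam0 lam1 r a b c : ℝ} {q d u w : ℝ → ℝ} (hα : 1 < α)
    (hlam0 : 0 < lam0) (hlam1 : 0 < lam1) (hr : 0 < r) (hq : ∀ x ∈ Ioo a b, 0 ≤ q x)
    (hu : IsPieceSolution α lam0 lam1 r a b c q d u)
    (hw : IsPieceSolution α lam0 lam1 r a b c q d w) : EqOn w u (Icc a b) := by
  have hA := depthConst_pos hα
  choose! pu hpu hdu hbu heu using hu.solves
  choose! pw hpw hdw hbw hew using hw.solves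
  -- Monotonicity: raising `y` to `z` raises `r * y` and lowers the gap term, so `p ^ (1 - α)` must
  -- grow and the slope must drop.
  have key : ∀ y z p p' B e : ℝ, 0 ≤ B → 0 < p → 0 < p' → 0 < y - e → 0 < z - e → y ≤ z →
      depthConst α * lam0 * p ^ (1 - α) + B * (y - e) ^ (1 - α) - r * y = 0 →
      depthConst α * lam0 * p' ^ (1 - α) + B * (z - e) ^ (1 - α) - r * z = 0 →
      p' ≤ p := by
    intro y z p p' B e hB hp hp' hy hz hyz h1 h2
    have h3 : (z - e) ^ (1 - α) ≤ (y - e) ^ (1 - α) :=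
      Real.rpow_le_rpow_of_nonpos hy (by linarith) (by linarith)
    have h4 := mul_le_mul_of_nonneg_left h3 hB
    have h5 := mul_le_mul_of_nonneg_left hyz hr.le
    by_contra! hlt
    have h6 : p' ^ (1 - α) < p ^ (1 - α) := Real.rpow_lt_rpow_of_neg hp hlt (by linarith)
    have h7 := mul_lt_mul_of_pos_left h6 (mul_pos hA hlam0)
    linarith
  have hanti : AntitoneOn (fun x => (u x - w x) ^ 2) (Icc a b) := by
    refine antitoneOn_of_hasDerivWithinAt_nonpos (convex_Icc a b)
      (f' := fun x => 2 * (u x - w x) * (pu x - pw x))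
      ((hu.continuousOn.sub hw.continuousOn).pow 2) ?_ ?_
    · intro x hx
      rw [interior_Icc] at hx ⊢
      have := (((hdu x hx).sub (hdw x hx)).pow 2).hasDerivWithinAt (s := Ioo a b)
      refine this.congr_deriv ?_
      simp
    · intro x hx
      rw [interior_Icc] at hx
      have hB : 0 ≤ depthConst α * lam1 * q x ^ α :=
        mul_nonneg (mul_pos hA hlam1).le (Real.rpow_nonneg (hq x hx) _)
      rcases le_total (u x) (w x) with h | h
      · have := key _ _ _ _ _ _ hB (hpu x hx) (hpw x hx) (hbu x hx) (hbw x hx) h (heu x hx)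
          (hew x hx)
        nlinarith
      · have := key _ _ _ _ _ _ hB (hpw x hx) (hpu x hx) (hbw x hx) (hbu x hx) h (hew x hx)
          (heu x hx)
        nlinarith
  intro x hx
  have h := hanti (left_mem_Icc.2 (hx.1.trans hx.2)) hx hx.1
  simp only [hu.initial, hw.initial, sub_self] at h
  have : (u x - w x) ^ 2 = 0 := le_antisymm (by simpa using h) (sq_nonneg _)
  have := pow_eq_zero_iff (two_ne_zero) |>.1 this
  linarith

/-! ### Existence on one interval -/

/-- Existence on `[a, b]` when the start is regular: the equation can be solved for a positive
slope at `a`, and `d` has a derivative on `(a, b]` that is bounded above away from `a`. -/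
lemma exists_solution_of_regular_start {α A B r a b c : ℝ} {d d' : ℝ → ℝ} (hα : 1 < α) (hA : 0 < A)
    (hB : 0 < B) (hr : 0 < r) (hab : a < b) (hd : ContinuousOn d (Icc a b))
    (hd' : ∀ x ∈ Ioc a b, HasDerivWithinAt d (d' x) (Icc a b) x)
    (hL : ∀ s, a < s → ∃ L, ∀ x ∈ Icc s b, d' x ≤ L) (hc : 0 < c - d a)
    (hG : B * (c - d a) ^ (1 - α) < r * c) :
    ∃ u p : ℝ → ℝ, u a = c ∧ (∃ P, ∀ x ∈ Icc a b, p x ≤ P) ∧ ∀ x ∈ Icc a b, 0 < p x ∧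
      HasDerivWithinAt u (p x) (Icc a b) x ∧ 0 < u x - d x ∧
        A * p x ^ (1 - α) + B * (u x - d x) ^ (1 - α) - r * u x = 0 := by
  have hα0 : 0 < α - 1 := by linarith
  obtain ⟨β, hβ, hβα⟩ : ∃ β : ℝ, 0 < β ∧ β * (α - 1) = 1 :=
    ⟨1 / (α - 1), by positivity, by field_simp⟩
  have hκ : 0 < A ^ β := Real.rpow_pos_of_pos hA _
  set κ := A ^ β with hκdef
  set m₀ := (c - d a) / 2 with hm₀def
  set ε₀ := (r * c - B * (c - d a) ^ (1 - α)) / 2 with hε₀def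
  have hm₀ : 0 < m₀ := by positivity
  have hε₀ : 0 < ε₀ := by rw [hε₀def]; linarith
  have haI : a ∈ Icc a b := left_mem_Icc.2 hab.le
  -- behaviour near the left end
  obtain ⟨s, hs, hsab⟩ : ∃ s, s ∈ Ioc a b ∧ ∀ x ∈ Icc a s,
      m₀ < c - d x ∧ ε₀ < r * c - B * (c - d x) ^ (1 - α) := by
    have h1 : ContinuousWithinAt (fun x => c - d x) (Icc a b) a :=
      continuousWithinAt_const.sub (hd a haI)
    have h2 : ContinuousWithinAt (fun x => r * c - B * (c - d x) ^ (1 - α)) (Icc a b) a :=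
      continuousWithinAt_const.sub (continuousWithinAt_const.mul
        (h1.rpow_const (Or.inl hc.ne')))
    have h3 := (h1.eventually (lt_mem_nhds (show m₀ < c - d a by rw [hm₀def]; linarith))).and
      (h2.eventually (lt_mem_nhds (show ε₀ < r * c - B * (c - d a) ^ (1 - α) by
        rw [hε₀def]; linarith)))
    rw [nhdsWithin_Icc_eq_nhdsGE hab] at h3
    obtain ⟨s, hs, hsub⟩ := (mem_nhdsGE_iff_exists_mem_Ioc_Ico_subset hab).1 h3
    refine ⟨(a + s) / 2, ⟨by linarith [hs.1], by linarith [hs.1, hs.2]⟩, fun x hx => ?_⟩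
    exact hsub ⟨hx.1, by linarith [hx.2, hs.1]⟩
  -- `d'` may blow up at `a`, as it does on the second piece. On `[a, s]` the bound `c ≤ u` alone
  -- will keep `G` above `ε₀`; the bound `L` serves on `[s, b]`.
  obtain ⟨L, hL⟩ := hL s hs.1
  obtain ⟨ε, hε, hεε, hLε⟩ := exists_mul_rpow_neg_gt hκ hβ L hε₀
  set P := κ * ε ^ (-β) with hPdef
  have hP : 0 < P := by positivity
  -- Slopes are at most `P`, so `u ≤ c + P * (b - a)`; with this `m`, a gap of at most `m` makes `Φ`
  -- negative.
  obtain ⟨m, hm, hmm, hmU⟩ := exists_mul_rpow_neg_gt hB hα0 (r * (c + P * (b - a))) hm₀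
  set Φ : ℝ → ℝ → ℝ := fun x y => r * y - B * max (y - d x) m ^ (-(α - 1)) with hΦ
  have hmax : ∀ y, 0 < max y m := fun y => lt_max_of_lt_right hm
  obtain ⟨u, hua, hu⟩ := exists_regularized_solution (κ := κ) (β := β) (ε := ε)
    (K := r + B * ((α - 1) * m ^ (-(α - 1) - 1))) hκ.le hβ hε (by positivity) hab.le c Φ
    (fun y => continuousOn_const.sub (continuousOn_const.mul
      (ContinuousOn.rpow_const ((continuousOn_const.sub hd).sup continuousOn_const)
        fun x _ => Or.inl (hmax _).ne')))
    (fun x _ y z => by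
      have h := abs_max_rpow_neg_sub_le hα0 hm (y - d x) (z - d x)
      rw [sub_sub_sub_cancel_right] at h
      have h2 : Φ x y - Φ x z = r * (y - z)
          - B * (max (y - d x) m ^ (-(α - 1)) - max (z - d x) m ^ (-(α - 1))) := by
        simp only [hΦ]; ring
      rw [h2]
      refine (abs_sub _ _).trans ?_
      rw [abs_mul, abs_mul, abs_of_pos hr, abs_of_pos hB, add_mul, mul_assoc B]
      gcongr)
  set p : ℝ → ℝ := fun x => κ * max (Φ x (u x)) ε ^ (-β) with hp
  have hp0 : ∀ x, 0 < p x := fun x =>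
    mul_pos hκ (Real.rpow_pos_of_pos (lt_max_of_lt_right hε) _)
  have hpP : ∀ x, p x ≤ P := fun x => mul_le_mul_of_nonneg_left
    (Real.rpow_le_rpow_of_nonpos hε (le_max_right _ _) (by linarith)) hκ.le
  have hucont : ContinuousOn u (Icc a b) := fun x hx => (hu x hx).continuousWithinAt
  have huc : ∀ x ∈ Icc a b, c ≤ u x := fun x hx => by
    have := monotoneOn_of_hasDerivWithinAt_nonneg (convex_Icc a b) hucont
      (fun y hy => (hu y (interior_subset hy)).mono interior_subset) (fun y _ => (hp0 y).le)
      haI hx hx.1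
    rwa [hua] at this
  have huU : ∀ x ∈ Icc a b, u x ≤ c + P * (b - a) := fun x hx => by
    have h := (convex_Icc a b).norm_image_sub_le_of_norm_hasDerivWithin_le hu
      (C := P) (fun y _ => by rw [Real.norm_eq_abs, abs_of_pos (hp0 y)]; exact hpP y) haI hx
    rw [Real.norm_eq_abs, Real.norm_eq_abs, abs_of_nonneg (sub_nonneg.2 hx.1), hua] at h
    have h2 := mul_le_mul_of_nonneg_left (sub_le_sub_right hx.2 a) hP.le
    linarith [le_abs_self (u x - c)]
  have hgap : ∀ x ∈ Icc a b, 0 ≤ Φ x (u x) → m < u x - d x := fun x hx h => by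
    by_contra! hle
    have h1 := mul_le_mul_of_nonneg_left (huU x hx) hr.le
    simp only [hΦ, max_eq_right hle] at h
    linarith
  set D : ℝ → ℝ := fun x => Φ x (u x) with hDdef
  have hudc : ContinuousOn (fun x => u x - d x) (Icc a b) := hucont.sub hd
  have hDc : ContinuousOn D (Icc a b) :=
    (continuousOn_const.mul hucont).sub (continuousOn_const.mul
      (ContinuousOn.rpow_const (hudc.sup continuousOn_const) fun x _ => Or.inl (hmax _).ne'))
  have hleft : ∀ x ∈ Icc a s, ε ≤ D x := fun x hx => by
    obtain ⟨h1, h2⟩ := hsab x hx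
    have h3 := huc x ⟨hx.1, hx.2.trans hs.2⟩
    have h4 : max (u x - d x) m = u x - d x := max_eq_left (by linarith)
    have h5 : (u x - d x) ^ (1 - α) ≤ (c - d x) ^ (1 - α) :=
      Real.rpow_le_rpow_of_nonpos (by linarith) (by linarith) (by linarith)
    have h6 := mul_le_mul_of_nonneg_left h5 hB.le
    have h7 := mul_le_mul_of_nonneg_left h3 hr.le
    simp only [hDdef, hΦ, h4, neg_sub]
    linarith
  -- Where `D x = ε`, the slope is `P > L ≥ d' x`, so both `u` and the gap increase, hence `D` does.
  have hright : ∀ x ∈ Icc s b, ε ≤ D x := by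
    refine le_of_deriv_pos_of_eq (hDc.mono (Icc_subset_Icc_left hs.1.le))
      (hleft s ⟨hs.1.le, le_rfl⟩) fun x hx hxε => ?_
    have hxI : x ∈ Icc a b := ⟨hs.1.le.trans hx.1, hx.2.le⟩
    have hg : m < u x - d x := hgap x hxI (hε.le.trans hxε.ge)
    have hg0 : 0 < u x - d x := hm.trans hg
    have hev : D =ᶠ[𝓝[Icc a b] x] fun z => r * u z - B * (u z - d z) ^ (-(α - 1)) := by
      filter_upwards [(hudc x hxI).eventually (lt_mem_nhds hg)] with z hz
      simp only [hDdef, hΦ, max_eq_left hz.le]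
    have hder := ((hu x hxI).const_mul r).sub
      (((((hu x hxI).sub (hd' x ⟨hs.1.trans_le hx.1, hx.2.le⟩))).rpow_const
        (p := -(α - 1)) (Or.inl hg0.ne')).const_mul B)
    refine ⟨_, ?_, ((hder.congr_of_eventuallyEq_of_mem hev hxI).of_Icc_Ici ⟨hxI.1, hx.2⟩)⟩
    have hpx : p x = P := by
      change κ * max (D x) ε ^ (-β) = P
      rw [hxε, max_self]
    change 0 < r * p x - B * ((p x - d' x) * -(α - 1) * (u x - d x) ^ (-(α - 1) - 1))
    have h1 : 0 < p x - d' x := by linarith [hL x ⟨hx.1, hx.2.le⟩]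
    have h2 := hp0 x
    have h3 : 0 < r * p x + B * ((p x - d' x) * (α - 1) * (u x - d x) ^ (-(α - 1) - 1)) := by
      positivity
    linarith
  have hDε : ∀ x ∈ Icc a b, ε ≤ D x := fun x hx =>
    (le_total x s).elim (fun h => hleft x ⟨hx.1, h⟩) (fun h => hright x ⟨h, hx.2⟩)
  refine ⟨u, p, hua, ⟨P, fun x _ => hpP x⟩, fun x hx => ⟨hp0 x, hu x hx, ?_, ?_⟩⟩
  · exact hm.trans (hgap x hx (hε.le.trans (hDε x hx)))
  · have h1 := hgap x hx (hε.le.trans (hDε x hx))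
    have h2 : p x = A ^ β * D x ^ (-β) := by
      change κ * max (D x) ε ^ (-β) = _
      rw [max_eq_left (hDε x hx)]
    rw [h2, mul_rpow_one_sub hβα hA (hε.trans_le (hDε x hx))]
    simp only [hDdef, hΦ, max_eq_left h1.le, neg_sub]
    ring

/-- Existence on `[0, b]` with the singular start `u(0) = 0`, by the substitution
`u = w ^ ((α - 1) / α)`, which makes the slope at `0` finite. -/
lemma exists_solution_of_singular_start {α A B r b : ℝ} (hα : 1 < α) (hA : 0 < A)
    (hB : 0 < B) (hr : 0 < r) (hb : 0 < b) :
    ∃ u p : ℝ → ℝ, u 0 = 0 ∧ ContinuousOn u (Icc 0 b) ∧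
      (∀ s, 0 < s → ∃ L, ∀ x ∈ Icc s b, p x ≤ L) ∧ ∀ x ∈ Ioc 0 b, 0 < p x ∧
      HasDerivWithinAt u (p x) (Icc 0 b) x ∧ 0 < u x ∧
        A * p x ^ (1 - α) + B * x ^ α * u x ^ (1 - α) - r * u x = 0 := by
  have hα0 : 0 < α - 1 := by linarith
  have hαp : 0 < α := by linarith
  obtain ⟨β, hβ, hβα⟩ : ∃ β : ℝ, 0 < β ∧ β * (α - 1) = 1 :=
    ⟨1 / (α - 1), by positivity, by field_simp⟩
  -- This exponent gives `(γ - 1) * (1 - α) = γ`, so after `u = w ^ γ` every term carries a factor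
  -- `w ^ γ`. What remains is `A γ ^ (1 - α) w' ^ (1 - α) + B x ^ α w ^ (1 - α) = r`.
  obtain ⟨γ, hγ, hγα⟩ : ∃ γ : ℝ, 0 < γ ∧ γ * α = α - 1 :=
    ⟨(α - 1) / α, by positivity, by field_simp⟩
  have hA' : 0 < A * γ ^ (1 - α) := by positivity
  have hκ : 0 < (A * γ ^ (1 - α)) ^ β := Real.rpow_pos_of_pos hA' _
  set κ := (A * γ ^ (1 - α)) ^ β with hκdef
  set k := κ * r ^ (-β) with hkdef
  have hk : 0 < k := by positivity
  -- `k` is the least possible slope of `w`, so `k * x ≤ w x` and this truncation will be inactive.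
  -- A floor proportional to `x` makes `ψ` of order `x` at `0` and Lipschitz in `y` uniformly in
  -- `x`.
  set ψ : ℝ → ℝ → ℝ := fun x y => x ^ α * max y (k * x) ^ (-(α - 1)) with hψ
  have hmax : ∀ {x} y, 0 < x → 0 < max y (k * x) := fun y hx =>
    lt_max_of_lt_right (mul_pos hk hx)
  have hpow : ∀ {x : ℝ}, 0 < x → x ^ α * (k * x) ^ (-(α - 1)) = k ^ (-(α - 1)) * x := by
    intro x hx
    rw [Real.mul_rpow hk.le hx.le, mul_left_comm, ← Real.rpow_add hx]
    simp
  have hψ0 : ∀ y, ψ 0 y = 0 := fun y => by simp [hψ, Real.zero_rpow hαp.ne']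
  have hψnn : ∀ x y, 0 ≤ x → 0 ≤ ψ x y := by
    intro x y hx
    rcases hx.eq_or_lt with rfl | hx
    · exact (hψ0 y).ge
    · have := hmax y hx
      positivity
  have hψle : ∀ x y, 0 ≤ x → ψ x y ≤ k ^ (-(α - 1)) * x := by
    intro x y hx
    rcases hx.eq_or_lt with rfl | hx
    · simp [hψ0]
    · rw [← hpow hx]
      exact mul_le_mul_of_nonneg_left (Real.rpow_le_rpow_of_nonpos (mul_pos hk hx)
        (le_max_right _ _) (by linarith)) (by positivity)
  have hψlip : ∀ x, 0 ≤ x → ∀ y z, |ψ x y - ψ x z| ≤ (α - 1) * k ^ (-α) * |y - z| := by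
    intro x hx y z
    rcases hx.eq_or_lt with rfl | hx
    · rw [hψ0, hψ0, sub_self, abs_zero]
      positivity
    · have h := abs_max_rpow_neg_sub_le hα0 (mul_pos hk hx) y z
      have hxa : 0 < x ^ α := Real.rpow_pos_of_pos hx _
      have h1 : x ^ α * (k * x) ^ (-(α - 1) - 1) = k ^ (-α) := by
        rw [show -(α - 1) - 1 = -α by ring, Real.mul_rpow hk.le hx.le, mul_left_comm,
          ← Real.rpow_add hx]
        simp
      simp only [hψ]
      rw [← mul_sub, abs_mul, abs_of_pos hxa, ← h1]
      calc _ ≤ x ^ α * _ := mul_le_mul_of_nonneg_left h hxa.le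
        _ = _ := by ring
  have hψx : ∀ y, ContinuousOn (fun x => ψ x y) (Icc 0 b) := by
    intro y x hx
    rcases hx.1.eq_or_lt with rfl | hx0
    · have hlim : Filter.Tendsto (fun x : ℝ => k ^ (-(α - 1)) * x) (𝓝[Icc 0 b] 0) (𝓝 0) := by
        have : ContinuousWithinAt (fun x : ℝ => k ^ (-(α - 1)) * x) (Icc 0 b) 0 := by fun_prop
        simpa [ContinuousWithinAt] using this
      have : Filter.Tendsto (fun x => ψ x y) (𝓝[Icc 0 b] 0) (𝓝 0) :=
        tendsto_of_tendsto_of_tendsto_of_le_of_le' tendsto_const_nhds hlim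
          (by filter_upwards [self_mem_nhdsWithin] with z hz using hψnn z y hz.1)
          (by filter_upwards [self_mem_nhdsWithin] with z hz using hψle z y hz.1)
      simpa [ContinuousWithinAt, hψ0] using this
    · refine ContinuousAt.continuousWithinAt ?_
      refine ContinuousAt.mul (Real.continuousAt_rpow_const _ _ (Or.inl hx0.ne')) ?_
      exact ContinuousAt.rpow_const (by fun_prop) (Or.inl (hmax y hx0).ne')
  obtain ⟨s, hs, hsb, hsr⟩ : ∃ s, 0 < s ∧ s ≤ b ∧ B * (k ^ (-(α - 1)) * s) ≤ r / 2 := by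
    refine ⟨min b (r / (2 * B * k ^ (-(α - 1)))), by positivity, min_le_left _ _, ?_⟩
    have := min_le_right b (r / (2 * B * k ^ (-(α - 1))))
    rw [le_div_iff₀ (by positivity)] at this
    linarith
  -- `D x = ε < r / 2` forces `w x ≤ W`. The next choice of `ε` gives `α * W < (α - 1) * s * P`,
  -- which makes `D` increase at such points of `[s, b]`.
  set W := (2 * B * b ^ α / r) ^ β with hWdef
  have hW : 0 < W := by positivity
  obtain ⟨ε, hε, hεr, hPε⟩ := exists_mul_rpow_neg_gt hκ hβ (α * W / ((α - 1) * s)) (half_pos hr)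
  set P := κ * ε ^ (-β) with hPdef
  have hP : 0 < P := by positivity
  obtain ⟨w, hw0, hw⟩ := exists_regularized_solution (κ := κ) (β := β) (ε := ε)
    (K := B * ((α - 1) * k ^ (-α))) hκ.le hβ hε (by positivity) hb.le 0 (fun x y => r - B * ψ x y)
    (fun y => continuousOn_const.sub (continuousOn_const.mul (hψx y)))
    (fun x hx y z => by
      rw [sub_sub_sub_cancel_left, ← mul_sub, abs_mul, abs_of_pos hB, abs_sub_comm, mul_assoc]
      exact mul_le_mul_of_nonneg_left (hψlip x hx.1 y z) hB.le)
  set D : ℝ → ℝ := fun x => r - B * ψ x (w x) with hD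
  set p : ℝ → ℝ := fun x => κ * max (D x) ε ^ (-β) with hp
  have hp0 : ∀ x, 0 < p x := fun x =>
    mul_pos hκ (Real.rpow_pos_of_pos (lt_max_of_lt_right hε) _)
  have hpP : ∀ x, p x ≤ P := fun x => mul_le_mul_of_nonneg_left
    (Real.rpow_le_rpow_of_nonpos hε (le_max_right _ _) (by linarith)) hκ.le
  have hpk : ∀ x ∈ Icc 0 b, k ≤ p x := fun x hx => by
    refine mul_le_mul_of_nonneg_left (Real.rpow_le_rpow_of_nonpos (lt_max_of_lt_right hε)
      (max_le ?_ (by linarith)) (by linarith)) hκ.le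
    have := mul_nonneg hB.le (hψnn x (w x) hx.1)
    simp only [hD]
    linarith
  have hwcont : ContinuousOn w (Icc 0 b) := fun x hx => (hw x hx).continuousWithinAt
  have hwk : ∀ x ∈ Icc 0 b, k * x ≤ w x := fun x hx => by
    have := monotoneOn_of_hasDerivWithinAt_nonneg (f := fun x => w x - k * x) (convex_Icc 0 b)
      (hwcont.sub (by fun_prop))
      (fun y hy => ((hw y (interior_subset hy)).mono interior_subset).sub
        ((hasDerivWithinAt_id y _).const_mul k))
      (fun y hy => by simpa using hpk y (interior_subset hy))
      (left_mem_Icc.2 hb.le) hx hx.1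
    simp only [hw0] at this
    linarith
  have hwpos : ∀ x ∈ Ioc 0 b, 0 < w x := fun x hx =>
    (mul_pos hk hx.1).trans_le (hwk x (Ioc_subset_Icc_self hx))
  have hDeq : ∀ x ∈ Icc 0 b, D x = r - B * (x ^ α * w x ^ (-(α - 1))) := fun x hx => by
    simp only [hD, hψ, max_eq_left (hwk x hx)]
  have hsub : Icc s b ⊆ Icc 0 b := Icc_subset_Icc_left hs.le
  have hder : ∀ x ∈ Ioc 0 b, HasDerivWithinAt D (-(B * (α * x ^ (α - 1) * w x ^ (-(α - 1)) +
      x ^ α * (p x * -(α - 1) * w x ^ (-(α - 1) - 1))))) (Icc 0 b) x := fun x hx => by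
    have hxI := Ioc_subset_Icc_self hx
    refine HasDerivWithinAt.congr_of_mem ?_ hDeq hxI
    exact (((Real.hasDerivAt_rpow_const (p := α) (Or.inl hx.1.ne')).hasDerivWithinAt.mul
      ((hw x hxI).rpow_const (p := -(α - 1)) (Or.inl (hwpos x hx).ne'))).const_mul B).const_sub r
  have hleft : ∀ x ∈ Icc 0 s, ε ≤ D x := fun x hx => by
    have h1 := mul_le_mul_of_nonneg_left (hψle x (w x) hx.1) hB.le
    have h2 : B * (k ^ (-(α - 1)) * x) ≤ B * (k ^ (-(α - 1)) * s) := by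
      have := hx.2
      gcongr
    simp only [hD]
    linarith
  have hright : ∀ x ∈ Icc s b, ε ≤ D x := by
    refine le_of_deriv_pos_of_eq
      (fun x hx => ((hder x ⟨hs.trans_le hx.1, hx.2⟩).continuousWithinAt).mono hsub)
      (hleft s ⟨hs.le, le_rfl⟩) fun x hx hxε => ?_
    have hx0 : 0 < x := hs.trans_le hx.1
    have hxI : x ∈ Ioc 0 b := ⟨hx0, hx.2.le⟩
    have hwx := hwpos x hxI
    refine ⟨_, ?_, (hder x hxI).of_Icc_Ici ⟨hx0.le, hx.2⟩⟩
    have hpx : p x = P := by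
      simp only [hp, hxε, max_self, hPdef]
    have hwW : w x ≤ W := by
      by_contra! hlt
      have h1 : w x ^ (-(α - 1)) ≤ W ^ (-(α - 1)) :=
        Real.rpow_le_rpow_of_nonpos hW hlt.le (by linarith)
      have h2 : W ^ (-(α - 1)) = r / (2 * B * b ^ α) := by
        rw [hWdef, ← Real.rpow_mul (by positivity), show β * -(α - 1) = -1 by linarith,
          Real.rpow_neg_one, inv_div]
      have h3 : x ^ α ≤ b ^ α := Real.rpow_le_rpow hx0.le hx.2.le hαp.le
      have h4 : x ^ α * w x ^ (-(α - 1)) ≤ b ^ α * (r / (2 * B * b ^ α)) := by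
        rw [← h2]
        gcongr
      have h5 := mul_le_mul_of_nonneg_left h4 hB.le
      have h6 : B * (b ^ α * (r / (2 * B * b ^ α))) = r / 2 := by
        field_simp
      rw [hDeq x (Ioc_subset_Icc_self hxI)] at hxε
      linarith
    have h1 : α * W < P * ((α - 1) * s) := (div_lt_iff₀ (by positivity)).1 hPε
    have h2 : α * w x ≤ α * W := by gcongr
    have h3 : P * ((α - 1) * s) ≤ P * ((α - 1) * x) := by
      have := hx.1
      gcongr
    have h4 : w x ^ (-(α - 1)) = w x ^ (-(α - 1) - 1) * w x := by
      rw [← Real.rpow_add_one hwx.ne', sub_add_cancel]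
    have h5 : x ^ α = x ^ (α - 1) * x := by
      rw [← Real.rpow_add_one hx0.ne', sub_add_cancel]
    rw [h4, h5, hpx]
    have h6 : 0 < B * x ^ (α - 1) * w x ^ (-(α - 1) - 1) * (P * ((α - 1) * x) - α * w x) :=
      mul_pos (by positivity) (by linarith)
    linarith
  have hDε : ∀ x ∈ Icc 0 b, ε ≤ D x := fun x hx =>
    (le_total x s).elim (fun h => hleft x ⟨hx.1, h⟩) (fun h => hright x ⟨h, hx.2⟩)
  refine ⟨fun x => w x ^ γ, fun x => p x * γ * w x ^ (γ - 1), ?_, ?_, ?_, ?_⟩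
  · simp [hw0, Real.zero_rpow hγ.ne']
  · exact hwcont.rpow_const fun x _ => Or.inr hγ.le
  · intro s hs
    refine ⟨P * γ * (k * s) ^ (γ - 1), fun x hx => ?_⟩
    have hxI : x ∈ Icc 0 b := ⟨hs.le.trans hx.1, hx.2⟩
    have h1 : k * s ≤ w x := (mul_le_mul_of_nonneg_left hx.1 hk.le).trans (hwk x hxI)
    have h2 : w x ^ (γ - 1) ≤ (k * s) ^ (γ - 1) :=
      Real.rpow_le_rpow_of_nonpos (by positivity) h1 (by nlinarith)
    have h3 := hpP x
    have h4 : 0 ≤ w x ^ (γ - 1) := Real.rpow_nonneg (by nlinarith [mul_pos hk hs]) _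
    exact mul_le_mul (mul_le_mul_of_nonneg_right h3 hγ.le) h2 h4 (by positivity)
  · intro x hx
    have hxI := Ioc_subset_Icc_self hx
    have hwx := hwpos x hx
    have hpx := hp0 x
    refine ⟨by positivity, (hw x hxI).rpow_const (Or.inl hwx.ne'), by positivity, ?_⟩
    have h1 : p x = (A * γ ^ (1 - α)) ^ β * D x ^ (-β) := by
      simp only [hp, max_eq_left (hDε x hxI), hκdef]
    have h2 := mul_rpow_one_sub hβα hA' (hε.trans_le (hDε x hxI))
    rw [← h1, hDeq x hxI] at h2
    have h3 : (p x * γ * w x ^ (γ - 1)) ^ (1 - α) = γ ^ (1 - α) * p x ^ (1 - α) * w x ^ γ := by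
      rw [Real.mul_rpow (by positivity) (by positivity), Real.mul_rpow hpx.le hγ.le,
        ← Real.rpow_mul hwx.le, show (γ - 1) * (1 - α) = γ by linarith]
      ring
    have h4 : (w x ^ γ) ^ (1 - α) = w x ^ γ * w x ^ (-(α - 1)) := by
      rw [← Real.rpow_mul hwx.le, ← Real.rpow_add hwx]
      congr 1
      linarith
    simp only [h3, h4]
    linear_combination (w x ^ γ) * h2

/-! ### Gluing and continuation -/

/-- The equation of `SolvesAt`, for the derivative `p` of `u` within `S`. -/
def SolvesWithin (α A B r q d : ℝ) (u : ℝ → ℝ) (S : Set ℝ) (x p : ℝ) : Prop :=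
  0 < p ∧ HasDerivWithinAt u p S x ∧ 0 < u x - d ∧
    A * p ^ (1 - α) + B * q ^ α * (u x - d) ^ (1 - α) - r * u x = 0

lemma SolvesWithin.congr {α A B r q d d' : ℝ} {u v : ℝ → ℝ} {S : Set ℝ} {x p : ℝ}
    (h : SolvesWithin α A B r q d u S x p) (hv : EqOn v u S) (hx : x ∈ S) (hd : d' = d) :
    SolvesWithin α A B r q d' v S x p := by
  subst hd
  obtain ⟨h1, h2, h3, h4⟩ := h
  refine ⟨h1, h2.congr hv (hv hx), ?_, ?_⟩ <;> rwa [hv hx]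

lemma SolvesWithin.solvesAt {α lam0 lam1 r q d : ℝ} {u : ℝ → ℝ} {S : Set ℝ} {x p : ℝ}
    (h : SolvesWithin α (depthConst α * lam0) (depthConst α * lam1) r q d u S x p)
    (hS : S ∈ 𝓝 x) : SolvesAt α lam0 lam1 r q d u x :=
  ⟨p, h.1, h.2.1.hasDerivAt hS, h.2.2⟩

/-- One-sided solutions on the two sides of a point form a solution at that point, since the
equation determines the slope. -/
lemma SolvesWithin.solvesAt_of_left_right {α lam0 lam1 r q d : ℝ} {u : ℝ → ℝ} {a x b p p' : ℝ}
    (hα : 1 < α) (hlam0 : 0 < lam0) (hax : a < x) (hxb : x < b)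
    (h : SolvesWithin α (depthConst α * lam0) (depthConst α * lam1) r q d u (Icc a x) x p)
    (h' : SolvesWithin α (depthConst α * lam0) (depthConst α * lam1) r q d u (Icc x b) x p') :
    SolvesAt α lam0 lam1 r q d u x := by
  obtain ⟨hp, hd, hpos, he⟩ := h
  obtain ⟨hp', hd', -, he'⟩ := h'
  have hA := mul_pos (depthConst_pos hα) hlam0
  have h1 : p ^ (1 - α) = p' ^ (1 - α) :=
    mul_left_cancel₀ hA.ne' (by linarith)
  have h2 : p = p' := (Real.rpow_left_inj hp.le hp'.le (by linarith)).1 h1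
  subst h2
  refine ⟨p, hp, ?_, hpos, he⟩
  have hl : HasDerivWithinAt u p (Iic x) x := hd.mono_of_mem_nhdsWithin (Icc_mem_nhdsLE hax)
  have hr : HasDerivWithinAt u p (Ici x) x := hd'.mono_of_mem_nhdsWithin (Icc_mem_nhdsGE hxb)
  simpa [Iic_union_Ici, hasDerivWithinAt_univ] using hl.union hr

/-- The properties of a solution `f.1` on `[a, a + δ]`, with derivative `f.2`, that allow its
continuation to `[a + δ, a + 2δ]`. -/
structure IsExtendable (α B r δ a : ℝ) (f : (ℝ → ℝ) × (ℝ → ℝ)) : Prop where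
  continuousOn : ContinuousOn f.1 (Icc a (a + δ))
  hasDeriv : ∀ x ∈ Ioc a (a + δ), HasDerivWithinAt f.1 (f.2 x) (Icc a (a + δ)) x
  bounded : ∀ s, a < s → ∃ L, ∀ x ∈ Icc s (a + δ), f.2 x ≤ L
  gap_pos : 0 < f.1 (a + δ) - f.1 a
  regular : B * δ ^ α * (f.1 (a + δ) - f.1 a) ^ (1 - α) < r * f.1 (a + δ)

/-- At the right end of the new piece, the equation with a positive slope gives `regular` for the
following one, since `A * p ^ (1 - α) > 0`. -/
lemma IsExtendable.exists_next {α A B r δ a : ℝ} {f : (ℝ → ℝ) × (ℝ → ℝ)} (hα : 1 < α)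
    (hA : 0 < A) (hB : 0 < B) (hr : 0 < r) (hδ : 0 < δ) (hf : IsExtendable α B r δ a f) :
    ∃ g : (ℝ → ℝ) × (ℝ → ℝ), IsExtendable α B r δ (a + δ) g ∧ g.1 (a + δ) = f.1 (a + δ) ∧
      ∀ x ∈ Icc (a + δ) (a + δ + δ), SolvesWithin α A B r δ (f.1 (x - δ)) g.1
        (Icc (a + δ) (a + δ + δ)) x (g.2 x) := by
  have hmaps : MapsTo (fun x => x - δ) (Icc (a + δ) (a + δ + δ)) (Icc a (a + δ)) :=
    fun x hx => ⟨by linarith [hx.1], by linarith [hx.2]⟩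
  obtain ⟨u, p, hu0, ⟨P, hP⟩, hu⟩ := exists_solution_of_regular_start (α := α) (A := A)
    (B := B * δ ^ α) (r := r) (a := a + δ) (b := a + δ + δ) (c := f.1 (a + δ))
    (d := fun x => f.1 (x - δ)) (d' := fun x => f.2 (x - δ)) hα hA (by positivity) hr
    (by linarith) (hf.continuousOn.comp (by fun_prop) hmaps)
    (fun x hx => by
      have h1 := hf.hasDeriv (x - δ) ⟨by linarith [hx.1], by linarith [hx.2]⟩
      have h2 := h1.comp x ((hasDerivWithinAt_id x _).sub_const δ) hmaps
      simpa [Function.comp_def] using h2)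
    (fun s hs => by
      obtain ⟨L, hL⟩ := hf.bounded (s - δ) (by linarith)
      exact ⟨L, fun x hx => hL _ ⟨by linarith [hx.1], by linarith [hx.2]⟩⟩)
    (by simpa using hf.gap_pos) (by simpa using hf.regular)
  refine ⟨(u, p), ⟨fun x hx => (hu x hx).2.1.continuousWithinAt,
    fun x hx => (hu x (Ioc_subset_Icc_self hx)).2.1,
    fun s hs => ⟨P, fun x hx => hP x ⟨hs.le.trans hx.1, hx.2⟩⟩, ?_, ?_⟩, hu0, hu⟩
  · have := (hu (a + δ + δ) ⟨by linarith, le_rfl⟩).2.2.1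
    rw [add_sub_cancel_right] at this
    simpa only [hu0] using this
  · obtain ⟨hp, -, -, he⟩ := hu (a + δ + δ) ⟨by linarith, le_rfl⟩
    rw [add_sub_cancel_right] at he
    have := mul_pos hA (Real.rpow_pos_of_pos hp (1 - α))
    simp only [hu0]
    linarith

/-- The successive pieces of the solution, with their derivatives. -/
lemma exists_pieces {α A B r δ : ℝ} (hα : 1 < α) (hA : 0 < A) (hB : 0 < B) (hr : 0 < r)
    (hδ : 0 < δ) : ∃ V p : ℕ → ℝ → ℝ, V 0 0 = 0 ∧ ContinuousOn (V 0) (Icc 0 δ) ∧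
      (∀ x ∈ Ioc 0 δ, SolvesWithin α A B r x 0 (V 0) (Icc 0 δ) x (p 0 x)) ∧
      ∀ n : ℕ, V (n + 1) (((n : ℝ) + 1) * δ) = V n (((n : ℝ) + 1) * δ) ∧
        ∀ x ∈ Icc (((n : ℝ) + 1) * δ) (((n : ℝ) + 2) * δ),
          SolvesWithin α A B r δ (V n (x - δ)) (V (n + 1))
            (Icc (((n : ℝ) + 1) * δ) (((n : ℝ) + 2) * δ)) x (p (n + 1) x) := by
  obtain ⟨u, p, hu0, huc, hL, hu⟩ := exists_solution_of_singular_start hα hA hB hr hδ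
  have hbase : IsExtendable α B r δ ((0 : ℕ) * δ) (u, p) := by
    have hend := hu δ ⟨hδ, le_rfl⟩
    have := mul_pos hA (Real.rpow_pos_of_pos hend.1 (1 - α))
    simp only [Nat.cast_zero, zero_mul]
    refine ⟨?_, ?_, ?_, ?_, ?_⟩ <;> simp only [zero_add, hu0, sub_zero]
    · exact huc
    · exact fun x hx => (hu x hx).2.1
    · exact hL
    · exact hend.2.2.1
    · linarith [hend.2.2.2]
  have hnext : ∀ (n : ℕ) (f : {f // IsExtendable α B r δ (n * δ) f}),
      ∃ g : {g // IsExtendable α B r δ ((n + 1 : ℕ) * δ) g},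
        g.1.1 (((n : ℝ) + 1) * δ) = f.1.1 (((n : ℝ) + 1) * δ) ∧
        ∀ x ∈ Icc (((n : ℝ) + 1) * δ) (((n : ℝ) + 2) * δ),
          SolvesWithin α A B r δ (f.1.1 (x - δ)) g.1.1
            (Icc (((n : ℝ) + 1) * δ) (((n : ℝ) + 2) * δ)) x (g.1.2 x) := by
    intro n f
    obtain ⟨g, hg, h⟩ := f.2.exists_next hα hA hB hr hδ
    have e1 : (n : ℝ) * δ + δ = ((n : ℝ) + 1) * δ := by ring
    have e2 : ((n : ℝ) + 1) * δ + δ = ((n : ℝ) + 2) * δ := by ring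
    rw [e1] at h hg
    rw [e2] at h
    exact ⟨⟨g, by push_cast; exact hg⟩, h⟩
  -- Carrying `IsExtendable` in a subtype turns the continuation step into a function that can be
  -- iterated.
  choose next hnext using hnext
  let F : (n : ℕ) → {f // IsExtendable α B r δ (n * δ) f} :=
    fun n => Nat.rec ⟨(u, p), hbase⟩ next n
  refine ⟨fun n => (F n).1.1, fun n => (F n).1.2, hu0, huc, fun x hx => ?_,
    fun n => hnext n (F n)⟩
  obtain ⟨h1, h2, h3, h4⟩ := hu x hx
  refine ⟨h1, h2, ?_, ?_⟩
  · change 0 < u x - 0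
    rwa [sub_zero]
  · change A * p x ^ (1 - α) + B * x ^ α * (u x - 0) ^ (1 - α) - r * u x = 0
    rwa [sub_zero]

/-! ### The solution on the half-line -/

lemma exists_nat_mem_Ioc_mul {δ x : ℝ} (hδ : 0 < δ) (hx : 0 < x) :
    ∃ n : ℕ, x ∈ Ioc ((n : ℝ) * δ) (((n : ℝ) + 1) * δ) := by
  have h0 : 0 < ⌈x / δ⌉₊ := Nat.ceil_pos.2 (by positivity)
  obtain ⟨n, hn⟩ := Nat.exists_eq_add_of_lt h0
  have h1 := Nat.ceil_lt_add_one (div_pos hx hδ).le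
  have h2 := Nat.le_ceil (x / δ)
  rw [hn] at h1 h2
  push_cast at h1 h2
  refine ⟨n, ?_, ?_⟩
  · rw [← lt_div_iff₀ hδ]; linarith
  · rw [← div_le_iff₀ hδ]; linarith

lemma not_mem_knots_of_mem_Ioo {δ x : ℝ} (hδ : 0 < δ) {n : ℕ}
    (hx : x ∈ Ioo ((n : ℝ) * δ) (((n : ℝ) + 1) * δ)) : x ∉ knots δ := by
  rintro ⟨m, rfl⟩
  have h1 : (n : ℝ) < m := lt_of_mul_lt_mul_right hx.1 hδ.le
  have h2 : (m : ℝ) < n + 1 := lt_of_mul_lt_mul_right hx.2 hδ.le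
  norm_cast at h1 h2
  omega

theorem lemma5p4 (α lam0 lam1 r δ : ℝ) (hα : 1 < α) (hlam0 : 0 < lam0) (hlam1 : 0 < lam1)
    (hr : 0 < r) (hδ : 0 < δ) :
    ∃ v : ℝ → ℝ,
      -- the equation holds at every point of `(0, ∞)`
      IsDelaySolution α lam0 lam1 r δ ∅ v ∧
      -- uniqueness, even if the equation is not imposed at the knots
      (∀ w : ℝ → ℝ, IsDelaySolution α lam0 lam1 r δ (knots δ) w → EqOn w v (Ici 0)) ∧
      -- the solution is obtained by successive patching
      ∃ V : ℕ → ℝ → ℝ,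
        IsUniquePieceSolution α lam0 lam1 r 0 δ 0 (fun x => x) (fun _ => 0) (V 0) ∧
        (∀ n : ℕ, IsUniquePieceSolution α lam0 lam1 r (((n : ℝ) + 1) * δ) (((n : ℝ) + 2) * δ)
          (V n (((n : ℝ) + 1) * δ)) (fun _ => δ) (fun x => V n (x - δ)) (V (n + 1))) ∧
        ∀ n : ℕ, EqOn v (V n) (Icc ((n : ℝ) * δ) (((n : ℝ) + 1) * δ)) := by
  obtain ⟨V, p, hV00, hV0c, hV0, hV⟩ := exists_pieces (r := r) (δ := δ) hα
    (mul_pos (depthConst_pos hα) hlam0) (mul_pos (depthConst_pos hα) hlam1) hr hδ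
  have hU0 : IsUniquePieceSolution α lam0 lam1 r 0 δ 0 (fun x => x) (fun _ => 0) (V 0) := by
    have h : IsPieceSolution α lam0 lam1 r 0 δ 0 (fun x => x) (fun _ => 0) (V 0) :=
      ⟨hV0c, hV00, fun x hx =>
        (hV0 x (Ioo_subset_Ioc_self hx)).solvesAt (Icc_mem_nhds hx.1 hx.2)⟩
    exact ⟨h, fun w hw => h.eqOn hα hlam0 hlam1 hr (fun x hx => hx.1.le) hw⟩
  have hU : ∀ n : ℕ, IsUniquePieceSolution α lam0 lam1 r (((n : ℝ) + 1) * δ) (((n : ℝ) + 2) * δ)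
      (V n (((n : ℝ) + 1) * δ)) (fun _ => δ) (fun x => V n (x - δ)) (V (n + 1)) := fun n => by
    have h : IsPieceSolution α lam0 lam1 r (((n : ℝ) + 1) * δ) (((n : ℝ) + 2) * δ)
        (V n (((n : ℝ) + 1) * δ)) (fun _ => δ) (fun x => V n (x - δ)) (V (n + 1)) :=
      ⟨fun x hx => ((hV n).2 x hx).2.1.continuousWithinAt, (hV n).1, fun x hx =>
        ((hV n).2 x (Ioo_subset_Icc_self hx)).solvesAt (Icc_mem_nhds hx.1 hx.2)⟩
    exact ⟨h, fun w hw => h.eqOn hα hlam0 hlam1 hr (fun _ _ => hδ.le) hw⟩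
  -- At a knot the floor selects the piece that starts there; agreement with the piece that ends
  -- there is the matching of initial values.
  set v : ℝ → ℝ := fun x => V ⌊x / δ⌋₊ x with hv
  have hvV : ∀ n : ℕ, EqOn v (V n) (Icc ((n : ℝ) * δ) (((n : ℝ) + 1) * δ)) := by
    intro n x hx
    have hn : ⌊((n : ℝ) + 1) * δ / δ⌋₊ = n + 1 := by
      rw [mul_div_cancel_right₀ _ hδ.ne']; exact_mod_cast Nat.floor_natCast (n + 1)
    rcases hx.2.eq_or_lt with rfl | hlt
    · simp only [hv, hn]
      exact (hV n).1
    · have : ⌊x / δ⌋₊ = n := (Nat.floor_eq_iff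
        (div_nonneg ((by positivity : (0 : ℝ) ≤ n * δ).trans hx.1) hδ.le)).2
        ⟨(le_div_iff₀ hδ).2 hx.1, (div_lt_iff₀ hδ).2 hlt⟩
      simp only [hv, this]
  have hvV' : ∀ n : ℕ, EqOn v (V (n + 1)) (Icc (((n : ℝ) + 1) * δ) (((n : ℝ) + 2) * δ)) := by
    intro n
    have h := hvV (n + 1)
    push_cast at h
    rwa [show (n : ℝ) + 1 + 1 = n + 2 by ring] at h
  have hv0 : v 0 = 0 := by
    rw [hvV 0 (by simp [hδ.le]), hV00]
  -- Here and in `hleft` the equation is phrased with `v` itself, so that at a knot it is literally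
  -- the same from both sides.
  have hright : ∀ n : ℕ, ∀ x ∈ Icc (((n : ℝ) + 1) * δ) (((n : ℝ) + 2) * δ),
      SolvesWithin α (depthConst α * lam0) (depthConst α * lam1) r (min x δ) (v (max (x - δ) 0)) v
        (Icc (((n : ℝ) + 1) * δ) (((n : ℝ) + 2) * δ)) x (p (n + 1) x) := by
    intro n x hx
    have h1 : (n : ℝ) * δ ≤ x - δ := by linarith [hx.1]
    have h0 : 0 ≤ (n : ℝ) * δ := by positivity
    rw [min_eq_right (by linarith), max_eq_left (by linarith)]
    exact ((hV n).2 x hx).congr (hvV' n) hx (hvV n ⟨h1, by linarith [hx.2]⟩)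
  have hleft : ∀ n : ℕ, ∀ x ∈ Ioc ((n : ℝ) * δ) (((n : ℝ) + 1) * δ),
      SolvesWithin α (depthConst α * lam0) (depthConst α * lam1) r (min x δ) (v (max (x - δ) 0)) v
        (Icc ((n : ℝ) * δ) (((n : ℝ) + 1) * δ)) x (p n x) := by
    intro n x hx
    rcases n with _ | n
    · have h := hvV 0
      simp only [Nat.cast_zero, zero_mul, zero_add, one_mul] at hx h ⊢
      rw [min_eq_left hx.2, max_eq_right (by linarith [hx.2]), hv0]
      exact (hV0 x hx).congr h (Ioc_subset_Icc_self hx) rfl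
    · push_cast at hx ⊢
      rw [show (n : ℝ) + 1 + 1 = n + 2 by ring] at hx ⊢
      exact hright n x (Ioc_subset_Icc_self hx)
  have hsol : ∀ x, 0 < x → SolvesAt α lam0 lam1 r (min x δ) (v (max (x - δ) 0)) v x := by
    intro x hx
    obtain ⟨n, hn⟩ := exists_nat_mem_Ioc_mul hδ hx
    rcases hn.2.eq_or_lt with rfl | hlt
    · exact (hleft n _ hn).solvesAt_of_left_right hα hlam0 hn.1
        (show ((n : ℝ) + 1) * δ < ((n : ℝ) + 2) * δ by linarith)
        (hright n _ ⟨le_rfl, by linarith⟩)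
    · exact (hleft n _ hn).solvesAt (Icc_mem_nhds hn.1 hlt)
  refine ⟨v, ⟨fun x hx => ?_, hv0, fun x hx _ => hsol x hx⟩, fun w hw => ?_, V, hU0, hU, hvV⟩
  · rcases (show (0 : ℝ) ≤ x from hx).eq_or_lt with rfl | hx
    · have h := hvV 0
      simp only [Nat.cast_zero, zero_mul, zero_add, one_mul] at h
      exact ((hV0c.congr h) 0 ⟨le_rfl, hδ.le⟩).mono_of_mem_nhdsWithin (Icc_mem_nhdsGE hδ)
    · obtain ⟨_, -, hd, -⟩ := hsol x hx
      exact hd.continuousAt.continuousWithinAt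
  · have hwV : ∀ n : ℕ, EqOn w (V n) (Icc ((n : ℝ) * δ) (((n : ℝ) + 1) * δ)) := by
      intro n
      induction n with
      | zero =>
        simp only [Nat.cast_zero, zero_mul, zero_add, one_mul]
        refine hU0.2 w ⟨hw.continuousOn.mono Icc_subset_Ici_self, hw.initial, fun x hx => ?_⟩
        have h := hw.solves x hx.1 (not_mem_knots_of_mem_Ioo hδ (n := 0) (by simpa using hx))
        rwa [min_eq_left hx.2.le, max_eq_right (by linarith [hx.2]), hw.initial] at h
      | succ n ih =>
        push_cast
        rw [show (n : ℝ) + 1 + 1 = n + 2 by ring]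
        have h0 : 0 ≤ (n : ℝ) * δ := by positivity
        refine (hU n).2 w ⟨hw.continuousOn.mono fun x hx => ?_, ih ⟨by linarith, le_rfl⟩,
          fun x hx => ?_⟩
        · exact mem_Ici.2 (by linarith [hx.1])
        · have h := hw.solves x (by linarith [hx.1]) (not_mem_knots_of_mem_Ioo hδ (n := n + 1) (by
            push_cast; exact ⟨hx.1, by linarith [hx.2]⟩))
          rwa [min_eq_right (by linarith [hx.1]), max_eq_left (by linarith [hx.1]),
            ih ⟨by linarith [hx.1], by linarith [hx.2]⟩] at h
    intro x hx
    rcases (show (0 : ℝ) ≤ x from hx).eq_or_lt with rfl | hx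
    · rw [hw.initial, hv0]
    · obtain ⟨n, hn⟩ := exists_nat_mem_Ioc_mul hδ hx
      rw [hwV n (Ioc_subset_Icc_self hn), hvV n (Ioc_subset_Icc_self hn)]
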